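/- Let $q=2^m$ with $m\ge 3$, let $h$ be a positive integer with $\gcd(m,h)=1$, let $\alpha$ be a generator of $\mathbb{F}_q^*$, and put $\alpha_i=\alpha^i$ for $1\le i\le q-1$. Let $\mathcal{C}_H\subseteq\mathbb{F}_q^{\,q-1}$ be the linear code generated by the rows of $$H=\begin{bmatrix}1&1&\cdots&1\\ \alpha_1^{2^h}&\alpha_2^{2^h}&\cdots&\alpha_{q-1}^{2^h}\\ \alpha_1^{2^h+1}&\alpha_2^{2^h+1}&\cdots&\alpha_{q-1}^{2^h+1}\end{bmatrix},$$ and let $\mathcal{C}_H^\perp$ be its dual with respect to the standard inner product. An $[n,k,d]$ code over $\mathbb{F}_q$ is a $k$-dimensional subspace of $\mathbb{F}_q^n$ with minimum Hamming distance $d$; it is AMDS if $d=n-k$, and NMDS if both it and its dual are AMDS. Its weight enumerator is $A(z)=\sum_{i=0}^n A_iz^i$, where $A_i$ is the number of codewords of Hamming weight $i$. The codewords of weight $w$ in a code $\mathcal{C}$ of length $n$ are said to support a $t$-$(n,w,\lambda)$ simple design if, in the multiset of the supports $\{i: c_i\ne0\}$ of all codewords $c\in\mathcal{C}$ of weight $w$,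 every support that occurs has multiplicity exactly $q-1$, and every $t$-subset of $\{1,\dots,n\}$ is contained in exactly $\lambda$ of the distinct supports. A simple $t$-$(n,k,1)$ design with $t\ge2$ is called a Steiner system $S(t,k,n)$. Then $\mathcal{C}_H$ is a $[q-1,3,q-4]$ NMDS code over $\mathbb{F}_q$ with weight enumerator $$A(z)=1+\frac{(q-1)^2(q-2)}{6}z^{q-4}+\frac{(q-1)^2(q+4)}{2}z^{q-2}+\frac{(q-1)(q^2+8)}{3}z^{q-1}.$$ Moreover, the minimum weight codewords of $\mathcal{C}_H$ support a $2$-$(q-1,q-4,\frac{(q-4)(q-5)}{6})$ simple design. The dual $\mathcal{C}_H^\perp$ is a $[q-1,q-4,3]$ code, and its minimum weight codewords support a $2$-$(q-1,3,1)$ simple design, i.e. a Steiner system $S(2,3,q-1)$. Furthermore, the codewords of weight $4$ in $\mathcal{C}_H^\perp$ support a $2$-$(q-1,4,\frac{(q-4)(q-7)}{2})$ simple design. -/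

import Mathlib

open Polynomial

noncomputable section

namespace NearMDS

variable {F : Type*} [Field F] [Fintype F] [DecidableEq F] {n : ℕ}

/-- The linear code generated by a matrix: the span of its rows. -/
def codeOfMatrix {k : ℕ} (G : Matrix (Fin k) (Fin n) F) : Submodule F (Fin n → F) :=
  Submodule.span F (Set.range fun i => G i)

/-- The dual code with respect to the standard inner product `∑ i, u i * c i`. -/
def dual (C : Submodule F (Fin n → F)) : Submodule F (Fin n → F) where
  carrier := {u | ∀ c ∈ C, u ⬝ᵥ c = 0}
  zero_mem' := fun c _ => zero_dotProduct c
  add_mem' := fun hu hv c hc => by rw [add_dotProduct, hu c hc, hv c hc, add_zero]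
  smul_mem' := fun a u hu c hc => by rw [smul_dotProduct, hu c hc, smul_zero]

/-- `d` is the minimum distance of `C`: the least Hamming distance between two different
codewords (in particular `C` has at least two codewords). -/
def HasMinDist (C : Submodule F (Fin n → F)) (d : ℕ) : Prop :=
  IsLeast {e | ∃ x ∈ C, ∃ y ∈ C, x ≠ y ∧ hammingDist x y = e} d

/-- `C`, of length `n`, is an `[n, k, d]` linear code. -/
def HasParameters (C : Submodule F (Fin n → F)) (k d : ℕ) : Prop :=
  Module.finrank F C = k ∧ HasMinDist C d

/-- Almost maximum distance separable: an `[n, k, n - k]` code, where `k` is the dimension. -/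
def IsAMDS (C : Submodule F (Fin n → F)) : Prop :=
  HasMinDist C (n - Module.finrank F C)

/-- Near maximum distance separable: the code and its dual are both AMDS. -/
def IsNMDS (C : Submodule F (Fin n → F)) : Prop :=
  IsAMDS C ∧ IsAMDS (dual C)

open Classical in
/-- The finite set of codewords of Hamming weight `w`. -/
def codewordsOfWeight (C : Submodule F (Fin n → F)) (w : ℕ) : Finset (Fin n → F) :=
  Finset.univ.filter fun c => c ∈ C ∧ hammingNorm c = w

/-- The weight enumerator `∑ i, A_i z ^ i`, `0 ≤ i ≤ n`, where `A_i` is the number of codewords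
of weight `i`. -/
def weightEnumerator (C : Submodule F (Fin n → F)) : ℚ[X] :=
  ∑ i ∈ Finset.range (n + 1), Polynomial.C ((codewordsOfWeight C i).card : ℚ) * X ^ i

/-- The support of a vector. -/
def supp (c : Fin n → F) : Finset (Fin n) :=
  Finset.univ.filter fun i => c i ≠ 0

/-- The multiset of the supports of all codewords of weight `w`. -/
def supportMultiset (C : Submodule F (Fin n → F)) (w : ℕ) : Multiset (Finset (Fin n)) :=
  (codewordsOfWeight C w).val.map supp

/-- `B` is a multiset of blocks of a `t`-`(n, k, lam)` design with point set `Fin n`. -/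
def IsDesign (t n k lam : ℕ) (B : Multiset (Finset (Fin n))) : Prop :=
  1 ≤ t ∧ t ≤ k ∧ k ≤ n ∧ (∀ b ∈ B, b.card = k) ∧
    ∀ T : Finset (Fin n), T.card = t → (B.filter fun b => T ⊆ b).card = lam

/-- A `t`-design without repeated blocks. -/
def IsSimpleDesign (t n k lam : ℕ) (B : Multiset (Finset (Fin n))) : Prop :=
  IsDesign t n k lam B ∧ B.Nodup

/-- A Steiner system `S(t, k, n)`. -/
def IsSteinerSystem (t k n : ℕ) (B : Multiset (Finset (Fin n))) : Prop :=
  2 ≤ t ∧ IsSimpleDesign t n k 1 B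

/-- `B` is the multiset `(1 / (q - 1)) {{ supp c : c ∈ C, wt c = w }}` with `q = |F|`: every
multiplicity of the multiset of supports is exactly `q - 1` times the multiplicity in `B`. -/
def IsBlocks (C : Submodule F (Fin n → F)) (w : ℕ) (B : Multiset (Finset (Fin n))) : Prop :=
  (Fintype.card F - 1) • B = supportMultiset C w

/-- The codewords of weight `w` in `C` support a simple `t`-`(n, w, lam)` design. -/
def SupportsSimpleDesign (C : Submodule F (Fin n → F)) (w t lam : ℕ) : Prop :=
  ∃ B, IsBlocks C w B ∧ IsSimpleDesign t n w lam B

/-- The codewords of weight `w` in `C` support a Steiner system `S(t, w, n)`. -/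
def SupportsSteinerSystem (C : Submodule F (Fin n → F)) (w t : ℕ) : Prop :=
  ∃ B, IsBlocks C w B ∧ IsSteinerSystem t w n B

/-- The `3 × n` matrix whose `i`-th column, `1 ≤ i ≤ n`, is `(1, x ^ (2 ^ h), x ^ (2 ^ h + 1))`
with `x = α ^ i`; the column index `i` is stored as `i - 1` in `Fin n`. -/
def matrixH (n h : ℕ) (α : Fˣ) : Matrix (Fin 3) (Fin n) F :=
  Matrix.of ![fun _ => 1,
    fun i => ((α : F) ^ ((i : ℕ) + 1)) ^ (2 ^ h),
    fun i => ((α : F) ^ ((i : ℕ) + 1)) ^ (2 ^ h + 1)]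

/-- The code generated by `matrixH`, of length `q - 1` with `q = |F|`. -/
def codeH (q h : ℕ) (α : Fˣ) : Submodule F (Fin (q - 1) → F) :=
  codeOfMatrix (matrixH (q - 1) h α)

end NearMDS

end

/-!
Put `s = 2 ^ h`. Since `gcd(m, h) = 1`, the map `y ↦ y ^ (s - 1)` permutes the nonzero elements of
the field and the only fixed points of `φ : y ↦ y ^ s` are `0` and `1`. Writing the evaluation
point `x` as `y ^ (-(s - 1))`, the column `(1, x ^ s, x ^ (s + 1))` becomes a multiple of
`(φ (φ y), φ y, y)`. So a codeword vanishes exactly at the nonzero roots `y` of a linearized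
polynomial `g₀ φ² + g₁ φ + g₂`. If this has two nonzero roots `a ≠ b`, its nonzero roots are
exactly `a`, `b`, `a + b` (`linearized_root_iff`). Thus the columns are the points of a Steiner
triple system, that of the points and lines of a projective space over the field of two elements,
and every line of the projective plane over `F` joining two columns meets the set of columns in a
block (`exists_isTripleConfiguration_matrixH`).

The rest only uses this configuration (`IsTripleConfiguration`). The zero set of a nonzero codeword
is empty, a single position, or a block, and every block occurs. A word of the dual code is a linear
relation among the columns; a linear form vanishing exactly on a block shows that the relation
cannot have a single term outside that block (`mem_line_of_mem_dual`). Hence supports of weight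
three are blocks and supports of weight four are four-element sets without a block. All of these
occur: the columns of a block lie in a plane, and any four columns are dependent. In all three
designs no nonzero codeword has its support strictly inside one of the supports considered, so a
support determines its codewords up to a scalar (`isBlocks_of_minimal_supports`). The block counts
are elementary counts in a Steiner triple system, and the weight distribution follows from the
number of blocks and two double counts.
-/

namespace NearMDS

/-! ### Steiner triple systems given by a third-point operation -/

section Triples

open Finset

variable {P : Type*}

/-- `t` is the third-point operation of a Steiner triple system on `P`: for `i ≠ j`, the unique
block through `i` and `j` is `{i, j, t i j}`. The values `t i i` are irrelevant. -/
structure IsThirdPoint (t : P → P → P) : Prop where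
  comm : ∀ i j, t i j = t j i
  ne_left : ∀ i j, i ≠ j → t i j ≠ i
  invol : ∀ i j, i ≠ j → t i (t i j) = j

theorem IsThirdPoint.ne_right {t : P → P → P} (ht : IsThirdPoint t) {i j : P} (hij : i ≠ j) :
    t i j ≠ j := by
  rw [ht.comm]; exact ht.ne_left j i hij.symm

theorem card_six_of_noncollinear [DecidableEq P] {t : P → P → P} (ht : IsThirdPoint t)
    {i j k : P} (hij : i ≠ j) (hki : k ≠ i) (hkj : k ≠ j) (hk : k ≠ t i j) :
    ({i, j, k, t i j, t i k, t j k} : Finset P).card = 6 := by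
  have c1 := ht.comm i j
  have c2 := ht.comm i k
  have c3 := ht.comm j k
  have a1 := ht.invol i j hij
  have a2 := ht.invol j i hij.symm
  have a3 := ht.invol i k hki.symm
  have a4 := ht.invol k i hki
  have a5 := ht.invol j k hkj.symm
  have a6 := ht.invol k j hkj
  have b1 := ht.ne_left i j hij
  have b2 := ht.ne_right hij
  have b3 := ht.ne_left i k hki.symm
  have b4 := ht.ne_right hki.symm
  have b5 := ht.ne_left j k hkj.symm
  have b6 := ht.ne_right hkj.symm
  rw [card_insert_of_notMem, card_insert_of_notMem, card_insert_of_notMem, card_insert_of_notMem,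
    card_insert_of_notMem, card_singleton] <;>
  simp only [mem_insert, mem_singleton] <;> grind

variable [Fintype P] [DecidableEq P]

/-- The blocks of the triple system with third-point operation `t`. -/
def lines (t : P → P → P) : Finset (Finset P) :=
  (univ.filter fun p : P × P => p.1 ≠ p.2).image fun p => {p.1, p.2, t p.1 p.2}

/-- The four-element sets that contain no block of the triple system. -/
def quadArcs (t : P → P → P) : Finset (Finset P) :=
  univ.filter fun S => S.card = 4 ∧ ∀ b ∈ lines t, ¬ b ⊆ S

variable {t : P → P → P}

theorem mem_lines {S : Finset P} : S ∈ lines t ↔ ∃ i j, i ≠ j ∧ S = {i, j, t i j} := by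
  simp [lines, eq_comm]

theorem line_mem_lines {i j : P} (hij : i ≠ j) : {i, j, t i j} ∈ lines t :=
  mem_lines.2 ⟨i, j, hij, rfl⟩

theorem card_of_mem_lines (ht : IsThirdPoint t) {S : Finset P} (hS : S ∈ lines t) :
    S.card = 3 := by
  obtain ⟨i, j, hij, rfl⟩ := mem_lines.1 hS
  exact card_eq_three.2 ⟨i, j, t i j, hij, (ht.ne_left i j hij).symm, (ht.ne_right hij).symm, rfl⟩

theorem eq_line_of_mem (ht : IsThirdPoint t) {S : Finset P} (hS : S ∈ lines t) {i j : P}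
    (hi : i ∈ S) (hj : j ∈ S) (hij : i ≠ j) : S = {i, j, t i j} := by
  obtain ⟨a, b, hab, rfl⟩ := mem_lines.1 hS
  have h1 := ht.comm a b
  have h2 := ht.comm a (t a b)
  have h3 := ht.comm b (t a b)
  have h4 := ht.invol a b hab
  have h5 := ht.invol b a hab.symm
  simp only [mem_insert, mem_singleton] at hi hj
  ext x
  simp only [mem_insert, mem_singleton]
  grind

theorem exists_mem_lines_avoiding (ht : IsThirdPoint t) (hP : 4 ≤ Fintype.card P) {j k : P}
    (hjk : j ≠ k) : ∃ S ∈ lines t, j ∈ S ∧ k ∉ S := by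
  obtain ⟨i, -, hi⟩ := exists_mem_notMem_of_card_lt_card (s := {j, k, t j k}) (t := univ)
    (lt_of_le_of_lt card_le_three (by rw [card_univ]; omega))
  simp only [mem_insert, mem_singleton, not_or] at hi
  have hji : j ≠ i := fun h => hi.1 h.symm
  refine ⟨_, line_mem_lines hji, by simp, fun hk => ?_⟩
  simp only [mem_insert, mem_singleton] at hk
  rcases hk with h | h | h
  · exact hjk h.symm
  · exact hi.2.1 h.symm
  · exact hi.2.2 (by rw [h, ht.invol j i hji])

theorem filter_lines_pair (ht : IsThirdPoint t) {i j : P} (hij : i ≠ j) :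
    (lines t).filter (fun S => i ∈ S ∧ j ∈ S) = {{i, j, t i j}} := by
  ext S
  simp only [mem_filter, mem_singleton]
  constructor
  · rintro ⟨hS, hi, hj⟩
    exact eq_line_of_mem ht hS hi hj hij
  · rintro rfl
    exact ⟨line_mem_lines hij, by simp, by simp⟩

theorem two_mul_card_lines_through (ht : IsThirdPoint t) (i : P) :
    2 * ((lines t).filter fun S => i ∈ S).card = Fintype.card P - 1 := by
  have h := card_mul_eq_card_mul (s := univ.erase i) (t := (lines t).filter fun S => i ∈ S)
    (fun j S => j ∈ S) (m := 1) (n := 2) ?_ ?_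
  · rw [card_erase_of_mem (mem_univ i), card_univ] at h
    omega
  · intro j hj
    rw [bipartiteAbove, filter_filter, filter_lines_pair ht (ne_of_mem_erase hj).symm,
      card_singleton]
  · intro S hS
    rw [mem_filter] at hS
    have : (univ.erase i).bipartiteBelow (fun j S => j ∈ S) S = S.erase i := by
      ext j; simp [bipartiteBelow]
    rw [this, card_erase_of_mem hS.2, card_of_mem_lines ht hS.1]

theorem six_mul_card_lines (ht : IsThirdPoint t) :
    6 * (lines t).card = Fintype.card P * (Fintype.card P - 1) := by
  have h := sum_card_bipartiteAbove_eq_sum_card_bipartiteBelow (s := univ) (t := lines t)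
    (fun (j : P) S => j ∈ S)
  have h1 : ∀ S ∈ lines t, (univ.bipartiteBelow (fun (j : P) S => j ∈ S) S).card = 3 := by
    intro S hS
    have : univ.bipartiteBelow (fun (j : P) S => j ∈ S) S = S := by
      ext j; simp [bipartiteBelow]
    rw [this, card_of_mem_lines ht hS]
  have h2 : ∑ i : P, 2 * ((lines t).bipartiteAbove (fun (j : P) S => j ∈ S) i).card
      = Fintype.card P * (Fintype.card P - 1) := by
    refine (sum_congr rfl fun i _ => two_mul_card_lines_through ht i).trans ?_
    rw [sum_const, card_univ, smul_eq_mul]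
  rw [sum_congr rfl h1, sum_const, smul_eq_mul] at h
  rw [← mul_sum, h] at h2
  omega

/-- Inclusion and exclusion over the blocks through `i` and the blocks through `j`. -/
theorem card_lines_avoiding (ht : IsThirdPoint t) {i j : P} (hij : i ≠ j) :
    ((lines t).filter fun S => i ∉ S ∧ j ∉ S).card + (Fintype.card P - 1)
      = (lines t).card + 1 := by
  have h1 := card_filter_add_card_filter_not (s := lines t) (fun S => i ∈ S)
  have h2 := card_filter_add_card_filter_not (s := (lines t).filter fun S => i ∉ S)
    (fun S => j ∈ S)
  have h3 := card_filter_add_card_filter_not (s := (lines t).filter fun S => j ∈ S)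
    (fun S => i ∈ S)
  have hi := two_mul_card_lines_through ht i
  have hj := two_mul_card_lines_through ht j
  have hp := congrArg card (filter_lines_pair ht hij)
  rw [card_singleton] at hp
  simp only [filter_filter] at h2 h3
  have e1 : (lines t).filter (fun S => j ∈ S ∧ i ∈ S) = (lines t).filter (fun S => i ∈ S ∧ j ∈ S) :=
    filter_congr fun S _ => and_comm
  have e2 : (lines t).filter (fun S => j ∈ S ∧ i ∉ S) = (lines t).filter (fun S => i ∉ S ∧ j ∈ S) :=
    filter_congr fun S _ => and_comm
  rw [e1, e2] at h3
  omega

theorem insert_mem_quadArcs_iff (ht : IsThirdPoint t) {i j k l : P} (hij : i ≠ j)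
    (hki : k ≠ i) (hkj : k ≠ j) (hk : k ≠ t i j) :
    ({l, i, j, k} : Finset P) ∈ quadArcs t ↔ l ∉ ({i, j, k, t i j, t i k, t j k} : Finset P) := by
  have hc : ({i, j, k} : Finset P).card = 3 :=
    card_eq_three.2 ⟨i, j, k, hij, hki.symm, hkj.symm, rfl⟩
  simp only [quadArcs, mem_filter, mem_univ, true_and]
  constructor
  · rintro ⟨h4, hl⟩ hmem
    have a1 := hl _ (line_mem_lines hij)
    have a2 := hl _ (line_mem_lines hki.symm)
    have a3 := hl _ (line_mem_lines hkj.symm)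
    have a4 : l ∉ ({i, j, k} : Finset P) := fun h => by
      rw [insert_eq_self.2 h] at h4; omega
    simp only [mem_insert, mem_singleton] at hmem a4
    simp only [insert_subset_iff, singleton_subset_iff, mem_insert, mem_singleton] at a1 a2 a3
    grind
  · intro hl
    simp only [mem_insert, mem_singleton, not_or] at hl
    obtain ⟨l1, l2, l3, l4, l5, l6⟩ := hl
    refine ⟨by rw [card_insert_of_notMem (by simp [l1, l2, l3]), hc], ?_⟩
    intro b hb hbS
    have hb3 := card_of_mem_lines ht hb
    by_cases hlb : l ∈ b
    · have h2 : 1 < (b.erase l).card := by rw [card_erase_of_mem hlb]; omega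
      obtain ⟨x, hx, y, hy, hxy⟩ := one_lt_card.1 h2
      have hx' := hbS (mem_of_mem_erase hx)
      have hy' := hbS (mem_of_mem_erase hy)
      have hlm := eq_line_of_mem ht hb (mem_of_mem_erase hx) (mem_of_mem_erase hy) hxy ▸ hlb
      have c1 := ht.comm i j
      have c2 := ht.comm i k
      have c3 := ht.comm j k
      simp only [mem_insert, mem_singleton, mem_erase] at hx hy hx' hy' hlm
      grind
    · have hsub : b ⊆ {i, j, k} := fun x hx => (mem_insert.1 (hbS hx)).resolve_left
        fun h => hlb (h ▸ hx)
      have hbe := eq_of_subset_of_card_le hsub (by omega)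
      have hkm : k ∈ ({i, j, t i j} : Finset P) := by
        rw [← eq_line_of_mem ht hb (by simp [hbe]) (by simp [hbe]) hij, hbe]
        simp
      simp only [mem_insert, mem_singleton] at hkm
      tauto

/-- Three points that are no block extend to a quadrangle without blocks in `|P| - 6` ways: the
fourth point avoids the three points and the third points of the three pairs. -/
theorem card_quadArcs_through_triple (ht : IsThirdPoint t) {i j k : P} (hij : i ≠ j)
    (hki : k ≠ i) (hkj : k ≠ j) (hk : k ≠ t i j) :
    ((quadArcs t).filter fun S => (i ∈ S ∧ j ∈ S) ∧ k ∈ S).card = Fintype.card P - 6 := by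
  have hc : ({i, j, k} : Finset P).card = 3 :=
    card_eq_three.2 ⟨i, j, k, hij, hki.symm, hkj.symm, rfl⟩
  rw [← card_six_of_noncollinear ht hij hki hkj hk, ← card_compl]
  symm
  refine card_bij (fun l _ => {l, i, j, k}) ?_ ?_ ?_
  · intro l hl
    rw [mem_compl] at hl
    rw [mem_filter]
    exact ⟨(insert_mem_quadArcs_iff ht hij hki hkj hk).2 hl, by simp⟩
  · intro l hl l' hl' h
    simp only [mem_compl, mem_insert, mem_singleton, not_or] at hl hl'
    have : l ∈ ({l', i, j, k} : Finset P) := h ▸ mem_insert_self _ _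
    simp only [mem_insert, mem_singleton] at this
    tauto
  · intro S hS
    obtain ⟨hq, ⟨hi, hj⟩, hkS⟩ := mem_filter.1 hS
    have h4 : S.card = 4 := (mem_filter.1 hq).2.1
    have hsub : {i, j, k} ⊆ S := by simp [insert_subset_iff, hi, hj, hkS]
    have h1 : (S \ {i, j, k}).card = 1 := by rw [card_sdiff_of_subset hsub]; omega
    obtain ⟨l, hl⟩ := card_eq_one.1 h1
    have hSl : {l, i, j, k} = S := by
      rw [insert_eq, ← hl, sdiff_union_of_subset hsub]
    refine ⟨l, ?_, hSl⟩
    rw [mem_compl]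
    exact (insert_mem_quadArcs_iff ht hij hki hkj hk).1 (hSl ▸ hq)

theorem two_mul_card_quadArcs_through_pair (ht : IsThirdPoint t) {i j : P} (hij : i ≠ j) :
    2 * ((quadArcs t).filter fun S => i ∈ S ∧ j ∈ S).card
      = (Fintype.card P - 3) * (Fintype.card P - 6) := by
  have h := card_mul_eq_card_mul (s := ({i, j, t i j} : Finset P)ᶜ)
    (t := (quadArcs t).filter fun S => i ∈ S ∧ j ∈ S)
    (fun k S => k ∈ S) (m := Fintype.card P - 6) (n := 2) ?_ ?_
  · rw [card_compl, card_of_mem_lines ht (line_mem_lines hij)] at h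
    omega
  · intro k hk
    simp only [mem_compl, mem_insert, mem_singleton, not_or] at hk
    rw [bipartiteAbove, filter_filter]
    exact card_quadArcs_through_triple ht hij hk.1 hk.2.1 hk.2.2
  · intro S hS
    obtain ⟨hq, hi, hj⟩ := mem_filter.1 hS
    obtain ⟨h4, hno⟩ := (mem_filter.1 hq).2
    have htS : t i j ∉ S := fun h => hno _ (line_mem_lines hij) (by
      simp [insert_subset_iff, hi, hj, h])
    have : ({i, j, t i j} : Finset P)ᶜ.bipartiteBelow (fun k S => k ∈ S) S = S \ {i, j} := by
      ext k
      simp only [bipartiteBelow, mem_filter, mem_compl, mem_sdiff, mem_insert, mem_singleton]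
      grind
    rw [this, card_sdiff_of_subset (by simp [insert_subset_iff, hi, hj]), card_pair hij, h4]

end Triples

/-! ### Supports of codewords and minimum distance -/

section Codes

variable {F : Type*} [Field F] {n : ℕ}

theorem mem_dual_codeOfMatrix {k : ℕ} {H : Matrix (Fin k) (Fin n) F} {u : Fin n → F} :
    u ∈ dual (codeOfMatrix H) ↔ Matrix.mulVec H u = 0 := by
  constructor
  · intro h
    ext r
    have := h (H r) (Submodule.subset_span ⟨r, rfl⟩)
    rw [dotProduct_comm] at this
    exact this
  · intro h c hc
    rw [codeOfMatrix] at hc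
    change c ∈ Submodule.span F (Set.range H.row) at hc
    rw [← range_vecMulLinear] at hc
    obtain ⟨f, rfl⟩ := hc
    rw [dotProduct_comm, Matrix.vecMulLinear_apply, ← Matrix.dotProduct_mulVec, h,
      dotProduct_zero]

theorem mem_codeOfMatrix {k : ℕ} {H : Matrix (Fin k) (Fin n) F} {c : Fin n → F} :
    c ∈ codeOfMatrix H ↔ ∃ f, Matrix.vecMul f H = c := by
  change c ∈ Submodule.span F (Set.range H.row) ↔ _
  rw [← range_vecMulLinear]
  rfl

variable [DecidableEq F]

theorem mem_supp {c : Fin n → F} {i : Fin n} : i ∈ supp c ↔ c i ≠ 0 := by simp [supp]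

theorem card_supp (c : Fin n → F) : (supp c).card = hammingNorm c := rfl

theorem supp_smul {a : F} (ha : a ≠ 0) (c : Fin n → F) : supp (a • c) = supp c := by
  ext i; simp [mem_supp, ha]

theorem hasMinDist_of_hammingNorm {C : Submodule F (Fin n → F)} {d : ℕ} (hd : 0 < d)
    (hex : ∃ c ∈ C, hammingNorm c = d) (hle : ∀ c ∈ C, c ≠ 0 → d ≤ hammingNorm c) :
    HasMinDist C d := by
  constructor
  · obtain ⟨c, hc, rfl⟩ := hex
    exact ⟨c, hc, 0, C.zero_mem, hammingNorm_pos_iff.1 hd, hammingDist_zero_right c⟩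
  · rintro e ⟨x, hx, y, hy, hxy, rfl⟩
    rw [hammingDist_eq_hammingNorm]
    exact hle _ (C.add_mem (C.neg_mem hx) hy) fun h => hxy (neg_add_eq_zero.1 h)

/-- Two codewords with the same support `b` are proportional when no nonzero codeword has its
support strictly inside `b`: a suitable combination of them vanishes at a point of `b`. -/
theorem exists_unit_smul_eq_of_supp_eq {C : Submodule F (Fin n → F)} {c c' : Fin n → F}
    (hc : c ∈ C) (hc' : c' ∈ C) (hcc : supp c' = supp c)
    (hmin : ∀ d ∈ C, supp d ⊂ supp c → d = 0) (hne : c ≠ 0) : ∃ a : Fˣ, c' = a • c := by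
  obtain ⟨k, hk⟩ := Function.ne_iff.1 hne
  have hk' : c' k ≠ 0 := mem_supp.1 (hcc ▸ mem_supp.2 hk)
  refine ⟨Units.mk0 (c' k / c k) (div_ne_zero hk' hk), ?_⟩
  have h0 := hmin (c' - (c' k / c k) • c) (C.sub_mem hc' (C.smul_mem _ hc)) ?_
  · exact sub_eq_zero.1 h0
  · refine (Finset.ssubset_iff_of_subset ?_).2 ⟨k, mem_supp.2 hk, ?_⟩
    · intro i hi
      by_contra hi0
      have h1 : c i = 0 := by simpa [mem_supp] using hi0
      rw [← hcc] at hi0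
      have h2 : c' i = 0 := by simpa [mem_supp] using hi0
      exact mem_supp.1 hi (by simp [h1, h2])
    · have : c k ≠ 0 := hk
      simp [mem_supp, this]

variable [Fintype F]

theorem mem_codewordsOfWeight {C : Submodule F (Fin n → F)} {w : ℕ} {c : Fin n → F} :
    c ∈ codewordsOfWeight C w ↔ c ∈ C ∧ hammingNorm c = w := by
  simp [codewordsOfWeight]

/-- A sufficient condition for `B` to be the set of supports of the codewords of weight `w`, each
support coming from exactly `q - 1` codewords. -/
theorem isBlocks_of_minimal_supports {C : Submodule F (Fin n → F)} {w : ℕ} (hw : 0 < w)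
    {B : Finset (Finset (Fin n))} (hcard : ∀ b ∈ B, b.card = w)
    (hex : ∀ b ∈ B, ∃ c ∈ C, supp c = b)
    (hsub : ∀ c ∈ C, hammingNorm c = w → supp c ∈ B)
    (hmin : ∀ b ∈ B, ∀ d ∈ C, supp d ⊂ b → d = 0) : IsBlocks C w B.val := by
  unfold IsBlocks supportMultiset
  ext b
  rw [Multiset.count_nsmul, Multiset.count_map, ← Finset.filter_val, Finset.card_val]
  by_cases hb : b ∈ B
  · obtain ⟨c, hc, rfl⟩ := hex b hb
    rw [Multiset.count_eq_one_of_mem B.nodup hb, mul_one, ← Fintype.card_units]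
    have hne : c ≠ 0 := hammingNorm_pos_iff.1 (by rw [← card_supp, hcard _ hb]; exact hw)
    obtain ⟨k, hk⟩ := Function.ne_iff.1 hne
    refine Finset.card_bij (fun (a : Fˣ) _ => a • c) ?_ ?_ ?_
    · intro a _
      have hs : supp (a • c) = supp c := supp_smul a.ne_zero c
      rw [Finset.mem_filter, mem_codewordsOfWeight, ← card_supp, hs]
      exact ⟨⟨C.smul_mem (a : F) hc, hcard _ hb⟩, rfl⟩
    · intro a _ a' _ h
      have := congrFun h k
      exact Units.ext (mul_right_cancel₀ hk this)
    · intro c' hc'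
      rw [Finset.mem_filter, mem_codewordsOfWeight] at hc'
      obtain ⟨a, ha⟩ := exists_unit_smul_eq_of_supp_eq hc hc'.1.1 hc'.2.symm (hmin _ hb) hne
      exact ⟨a, Finset.mem_univ _, ha.symm⟩
  · rw [Multiset.count_eq_zero_of_notMem hb, mul_zero, eq_comm, Finset.card_eq_zero,
      Finset.filter_eq_empty_iff]
    rintro c hc rfl
    rw [mem_codewordsOfWeight] at hc
    exact hb (hsub c hc.1 hc.2)

theorem IsBlocks.card_codewordsOfWeight {C : Submodule F (Fin n → F)} {w : ℕ}
    {B : Finset (Finset (Fin n))} (h : IsBlocks C w B.val) :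
    (codewordsOfWeight C w).card = (Fintype.card F - 1) * B.card := by
  have := congrArg Multiset.card h
  rw [Multiset.card_nsmul, supportMultiset, Multiset.card_map] at this
  exact this.symm

theorem isSimpleDesign_two {w lam : ℕ} (hw : 2 ≤ w) (hn : w ≤ n)
    {B : Finset (Finset (Fin n))} (hcard : ∀ b ∈ B, b.card = w)
    (hpair : ∀ i j, i ≠ j → (B.filter fun b => i ∈ b ∧ j ∈ b).card = lam) :
    IsSimpleDesign 2 n w lam B.val := by
  refine ⟨⟨by norm_num, hw, hn, hcard, ?_⟩, B.nodup⟩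
  intro T hT
  obtain ⟨i, j, hij, rfl⟩ := Finset.card_eq_two.1 hT
  rw [← Finset.filter_val, Finset.card_val, ← hpair i j hij]
  congr 1
  ext b
  simp [Finset.insert_subset_iff]

end Codes

/-! ### Codes whose columns form a Steiner triple system -/

section Configuration

open Matrix

variable {F : Type*} [Field F] {n : ℕ}

/-- The columns of `H`, seen as points of the projective plane over `F`, form a configuration in
which every line through two of the points contains exactly one more point, given by `t`.
A line is the zero set of a linear form `f`, whose values at the columns are `f ᵥ* H`. -/
structure IsTripleConfiguration (H : Matrix (Fin 3) (Fin n) F) (t : Fin n → Fin n → Fin n) :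
    Prop extends IsThirdPoint t where
  zero_iff : ∀ f, f ≠ 0 → ∀ i j, i ≠ j → (f ᵥ* H) i = 0 → (f ᵥ* H) j = 0 →
    ∀ k, (f ᵥ* H) k = 0 ↔ k ∈ ({i, j, t i j} : Finset (Fin n))

theorem hammingNorm_add_card_compl_supp [DecidableEq F] (c : Fin n → F) :
    hammingNorm c + (supp c)ᶜ.card = n := by
  rw [← card_supp, Finset.card_add_card_compl, Fintype.card_fin]

theorem exists_form_vanishing_at_pair (H : Matrix (Fin 3) (Fin n) F) (i j : Fin n) :
    ∃ f ≠ 0, (f ᵥ* H) i = 0 ∧ (f ᵥ* H) j = 0 := by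
  let φ : (Fin 3 → F) →ₗ[F] F × F :=
    ((LinearMap.proj i).comp H.vecMulLinear).prod ((LinearMap.proj j).comp H.vecMulLinear)
  have hφ : LinearMap.ker φ ≠ ⊥ := LinearMap.ker_ne_bot_of_finrank_lt (by simp)
  obtain ⟨f, hf, hf0⟩ := (Submodule.ne_bot_iff _).1 hφ
  have : φ f = 0 := hf
  exact ⟨f, hf0, congrArg Prod.fst this, congrArg Prod.snd this⟩

variable {H : Matrix (Fin 3) (Fin n) F} {t : Fin n → Fin n → Fin n}

namespace IsTripleConfiguration

theorem exists_form_of_mem_lines (hc : IsTripleConfiguration H t) {S : Finset (Fin n)}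
    (hS : S ∈ lines t) : ∃ f ≠ 0, ∀ k, (f ᵥ* H) k = 0 ↔ k ∈ S := by
  obtain ⟨i, j, hij, rfl⟩ := mem_lines.1 hS
  obtain ⟨f, hf, hi, hj⟩ := exists_form_vanishing_at_pair H i j
  exact ⟨f, hf, hc.zero_iff f hf i j hij hi hj⟩

variable [DecidableEq F]

theorem card_compl_supp_cases (hc : IsTripleConfiguration H t) {f : Fin 3 → F} (hf : f ≠ 0) :
    (supp (f ᵥ* H))ᶜ.card = 0 ∨ (supp (f ᵥ* H))ᶜ.card = 1 ∨ (supp (f ᵥ* H))ᶜ ∈ lines t := by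
  by_cases h : 1 < (supp (f ᵥ* H))ᶜ.card
  · obtain ⟨i, hi, j, hj, hij⟩ := Finset.one_lt_card.1 h
    simp only [Finset.mem_compl, mem_supp, not_not] at hi hj
    refine Or.inr (Or.inr (mem_lines.2 ⟨i, j, hij, ?_⟩))
    ext k
    rw [Finset.mem_compl, mem_supp, not_not, hc.zero_iff f hf i j hij hi hj]
  · omega

theorem card_compl_supp (hc : IsTripleConfiguration H t) {f : Fin 3 → F} (hf : f ≠ 0) :
    (supp (f ᵥ* H))ᶜ.card = 0 ∨ (supp (f ᵥ* H))ᶜ.card = 1 ∨ (supp (f ᵥ* H))ᶜ.card = 3 := by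
  rcases hc.card_compl_supp_cases hf with h | h | h
  · exact Or.inl h
  · exact Or.inr (Or.inl h)
  · exact Or.inr (Or.inr (card_of_mem_lines hc.toIsThirdPoint h))

theorem hammingNorm_cases (hc : IsTripleConfiguration H t) (hn : 4 ≤ n) {f : Fin 3 → F}
    (hf : f ≠ 0) : hammingNorm (f ᵥ* H) = n ∨ hammingNorm (f ᵥ* H) = n - 1 ∨
      hammingNorm (f ᵥ* H) = n - 3 := by
  have := hammingNorm_add_card_compl_supp (f ᵥ* H)
  have := hc.card_compl_supp hf
  omega

theorem vecMul_ne_zero (hc : IsTripleConfiguration H t) (hn : 4 ≤ n) {f : Fin 3 → F}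
    (hf : f ≠ 0) : f ᵥ* H ≠ 0 := by
  rw [← hammingNorm_pos_iff]
  have := hammingNorm_add_card_compl_supp (f ᵥ* H)
  have := hc.card_compl_supp hf
  omega

theorem vecMul_injective (hc : IsTripleConfiguration H t) (hn : 4 ≤ n) :
    Function.Injective fun f => f ᵥ* H := by
  intro f g h
  by_contra hfg
  refine hc.vecMul_ne_zero hn (sub_ne_zero.2 hfg) ?_
  rw [Matrix.sub_vecMul]
  exact sub_eq_zero.2 h

theorem sub_three_le_hammingNorm (hc : IsTripleConfiguration H t) {c : Fin n → F}
    (hcC : c ∈ codeOfMatrix H) (h0 : c ≠ 0) : n - 3 ≤ hammingNorm c := by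
  obtain ⟨f, rfl⟩ : ∃ f, f ᵥ* H = c := mem_codeOfMatrix.1 hcC
  have hf : f ≠ 0 := by rintro rfl; exact h0 (Matrix.zero_vecMul H)
  have := hammingNorm_add_card_compl_supp (f ᵥ* H)
  have := hc.card_compl_supp hf
  omega

theorem exists_mem_supp_eq_compl (hc : IsTripleConfiguration H t) {S : Finset (Fin n)}
    (hS : S ∈ lines t) : ∃ c ∈ codeOfMatrix H, supp c = Sᶜ := by
  obtain ⟨f, -, hf⟩ := hc.exists_form_of_mem_lines hS
  refine ⟨f ᵥ* H, mem_codeOfMatrix.2 ⟨f, rfl⟩, ?_⟩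
  ext k
  rw [mem_supp, Finset.mem_compl, ne_eq, hf]

theorem hasMinDist_code (hc : IsTripleConfiguration H t) (hn : 4 ≤ n) :
    HasMinDist (codeOfMatrix H) (n - 3) := by
  refine hasMinDist_of_hammingNorm (by omega) ?_ fun c => hc.sub_three_le_hammingNorm
  have hS := line_mem_lines (t := t) (i := ⟨0, by omega⟩) (j := ⟨1, by omega⟩) (by simp)
  obtain ⟨c, hcC, h⟩ := hc.exists_mem_supp_eq_compl hS
  refine ⟨c, hcC, ?_⟩
  rw [← card_supp, h, Finset.card_compl, card_of_mem_lines hc.toIsThirdPoint hS, Fintype.card_fin]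

theorem finrank_code (hc : IsTripleConfiguration H t) (hn : 4 ≤ n) :
    Module.finrank F (codeOfMatrix H) = 3 := by
  change Module.finrank F (Submodule.span F (Set.range H.row)) = 3
  rw [← range_vecMulLinear, LinearMap.finrank_range_of_inj (hc.vecMul_injective hn)]
  simp

theorem finrank_dual (hc : IsTripleConfiguration H t) (hn : 4 ≤ n) :
    Module.finrank F (dual (codeOfMatrix H)) = n - 3 := by
  have h1 : dual (codeOfMatrix H) = LinearMap.ker H.mulVecLin := by
    ext u
    rw [mem_dual_codeOfMatrix]
    rfl
  have h2 : Module.finrank F (LinearMap.range H.mulVecLin) = 3 := by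
    change H.rank = 3
    rw [← Matrix.rank_transpose, Matrix.rank, Matrix.mulVecLin_transpose,
      LinearMap.finrank_range_of_inj (hc.vecMul_injective hn)]
    simp
  have h3 := LinearMap.finrank_range_add_finrank_ker H.mulVecLin
  rw [h2, ← h1, Module.finrank_fin_fun] at h3
  omega

/-! ### The dual code -/

/-- A relation among the columns cannot involve exactly one column outside a block: the linear
form vanishing precisely on that block would kill all terms but one. -/
theorem mem_line_of_mem_dual (hc : IsTripleConfiguration H t) {u : Fin n → F}
    (hu : u ∈ dual (codeOfMatrix H)) {k : Fin n} (hk : k ∈ supp u) {S : Finset (Fin n)}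
    (hS : S ∈ lines t) (hsub : (supp u).erase k ⊆ S) : k ∈ S := by
  obtain ⟨f, -, hf⟩ := hc.exists_form_of_mem_lines hS
  have h := hu (f ᵥ* H) (mem_codeOfMatrix.2 ⟨f, rfl⟩)
  rw [dotProduct, Finset.sum_eq_single k] at h
  · exact (hf k).1 ((mul_eq_zero.1 h).resolve_left (mem_supp.1 hk))
  · intro i _ hik
    by_cases hi : u i = 0
    · rw [hi, zero_mul]
    · rw [(hf i).2 (hsub (Finset.mem_erase.2 ⟨hik, mem_supp.2 hi⟩)), mul_zero]
  · simp

theorem three_le_hammingNorm_dual (hc : IsTripleConfiguration H t) (hn : 4 ≤ n)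
    {u : Fin n → F} (hu : u ∈ dual (codeOfMatrix H)) (h0 : u ≠ 0) : 3 ≤ hammingNorm u := by
  by_contra hlt
  obtain ⟨k, hk⟩ : (supp u).Nonempty := by
    rw [← Finset.card_pos, card_supp]
    exact hammingNorm_pos_iff.2 h0
  have hcard : ((supp u).erase k).card ≤ 1 := by
    rw [Finset.card_erase_of_mem hk, card_supp]
    omega
  obtain ⟨j, hjk, hj⟩ : ∃ j, j ≠ k ∧ (supp u).erase k ⊆ {j} := by
    rcases Finset.eq_empty_or_nonempty ((supp u).erase k) with h | ⟨j, hj⟩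
    · have : Nontrivial (Fin n) := Fin.nontrivial_iff_two_le.2 (by omega)
      obtain ⟨j, hj⟩ := exists_ne k
      exact ⟨j, hj, by simp [h]⟩
    · exact ⟨j, Finset.ne_of_mem_erase hj, fun x hx => Finset.mem_singleton.2
        (Finset.card_le_one.1 hcard x hx j hj)⟩
  obtain ⟨S, hS, hjS, hkS⟩ := exists_mem_lines_avoiding hc.toIsThirdPoint (by simpa using hn) hjk
  exact hkS (hc.mem_line_of_mem_dual hu hk hS (hj.trans (by simpa using hjS)))

theorem supp_mem_lines_of_mem_dual (hc : IsTripleConfiguration H t) {u : Fin n → F}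
    (hu : u ∈ dual (codeOfMatrix H)) (h3 : hammingNorm u = 3) : supp u ∈ lines t := by
  obtain ⟨i, j, k, hij, hik, hjk, hs⟩ := Finset.card_eq_three.1 ((card_supp u).trans h3)
  have hk := hc.mem_line_of_mem_dual hu (k := k) (by simp [hs]) (line_mem_lines hij) (by
    rw [hs]
    intro x hx
    simp only [Finset.mem_erase, Finset.mem_insert, Finset.mem_singleton] at hx ⊢
    tauto)
  simp only [Finset.mem_insert, Finset.mem_singleton] at hk
  have hk' : k = t i j := by tauto
  rw [hs, hk']
  exact line_mem_lines hij

theorem supp_mem_quadArcs_of_mem_dual (hc : IsTripleConfiguration H t)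
    {u : Fin n → F} (hu : u ∈ dual (codeOfMatrix H)) (h4 : hammingNorm u = 4) :
    supp u ∈ quadArcs t := by
  rw [quadArcs, Finset.mem_filter]
  refine ⟨Finset.mem_univ _, (card_supp u).trans h4, fun b hb hbs => ?_⟩
  have h1 : (supp u \ b).card = 1 := by
    rw [Finset.card_sdiff_of_subset hbs, card_of_mem_lines hc.toIsThirdPoint hb, card_supp, h4]
  obtain ⟨l, hl⟩ := Finset.card_eq_one.1 h1
  have hl' : l ∈ supp u \ b := by simp [hl]
  rw [Finset.mem_sdiff] at hl'
  refine hl'.2 (hc.mem_line_of_mem_dual hu hl'.1 hb fun x hx => ?_)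
  by_contra hxb
  have : x ∈ supp u \ b := Finset.mem_sdiff.2 ⟨Finset.mem_of_mem_erase hx, hxb⟩
  rw [hl, Finset.mem_singleton] at this
  exact Finset.ne_of_mem_erase hx this

end IsTripleConfiguration

/-- If the columns of `H` indexed by `T` are linearly dependent, because the combinations of them
lie in a subspace `W` of dimension less than `|T|`, the dual code has a nonzero word supported
in `T`. -/
theorem exists_mem_dual_supp_subset [DecidableEq F] (T : Finset (Fin n))
    (W : Submodule F (Fin 3 → F)) (hW : Module.finrank F W < T.card)
    (hTW : ∀ u : Fin n → F, supp u ⊆ T → H *ᵥ u ∈ W) :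
    ∃ u ∈ dual (codeOfMatrix H), u ≠ 0 ∧ supp u ⊆ T := by
  let E : (T → F) →ₗ[F] (Fin n → F) := Function.ExtendByZero.linearMap F Subtype.val
  have hE : ∀ (x : T → F) (i : T), E x i = x i := fun x i =>
    Subtype.val_injective.extend_apply x (0 : Fin n → F) i
  have hE' : ∀ x, supp (E x) ⊆ T := by
    intro x i hi
    by_contra hiT
    have h0 : E x i = (0 : Fin n → F) i :=
      Function.extend_apply' x (0 : Fin n → F) i (by rintro ⟨a, rfl⟩; exact hiT a.2)
    exact mem_supp.1 hi h0
  let φ : (T → F) →ₗ[F] W := (H.mulVecLin.comp E).codRestrict W fun x => hTW _ (hE' x)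
  have hφ : LinearMap.ker φ ≠ ⊥ := LinearMap.ker_ne_bot_of_finrank_lt (by simpa using hW)
  obtain ⟨x, hx, hx0⟩ := (Submodule.ne_bot_iff _).1 hφ
  refine ⟨E x, mem_dual_codeOfMatrix.2 ?_, ?_, hE' x⟩
  · have : φ x = 0 := hx
    exact congrArg Subtype.val this
  · intro h
    refine hx0 (funext fun i => ?_)
    rw [← hE x i, h]
    rfl

namespace IsTripleConfiguration

variable [DecidableEq F]

theorem exists_mem_dual_supp_eq_line (hc : IsTripleConfiguration H t) (hn : 4 ≤ n)
    {S : Finset (Fin n)} (hS : S ∈ lines t) : ∃ u ∈ dual (codeOfMatrix H), supp u = S := by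
  obtain ⟨f, hf0, hf⟩ := hc.exists_form_of_mem_lines hS
  have hcard := card_of_mem_lines hc.toIsThirdPoint hS
  -- the columns of a block lie in the plane orthogonal to `f`
  have hrank := Module.Dual.finrank_ker_add_one_of_ne_zero
    ((dotProductEquiv F (Fin 3)).map_ne_zero_iff.2 hf0)
  rw [Module.finrank_fin_fun] at hrank
  have hker : ∀ u : Fin n → F, supp u ⊆ S →
      H *ᵥ u ∈ LinearMap.ker (dotProductEquiv F (Fin 3) f) := by
    intro u hus
    rw [LinearMap.mem_ker, dotProductEquiv_apply_apply, Matrix.dotProduct_mulVec, dotProduct]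
    refine Finset.sum_eq_zero fun i _ => ?_
    by_cases hi : i ∈ S
    · rw [(hf i).2 hi, zero_mul]
    · have : u i = 0 := by
        by_contra h0
        exact hi (hus (mem_supp.2 h0))
      rw [this, mul_zero]
  obtain ⟨u, hu, hu0, hus⟩ := exists_mem_dual_supp_subset (H := H) S _ (by omega) hker
  refine ⟨u, hu, Finset.eq_of_subset_of_card_le hus ?_⟩
  rw [hcard, card_supp]
  exact hc.three_le_hammingNorm_dual hn hu hu0

theorem exists_mem_dual_supp_eq_quadArc (hc : IsTripleConfiguration H t) (hn : 4 ≤ n)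
    {S : Finset (Fin n)} (hS : S ∈ quadArcs t) : ∃ u ∈ dual (codeOfMatrix H), supp u = S := by
  obtain ⟨h4, hno⟩ := (Finset.mem_filter.1 hS).2
  obtain ⟨u, hu, hu0, hus⟩ := exists_mem_dual_supp_subset (H := H) S ⊤
    (by rw [h4, finrank_top]; simp) fun _ _ => Submodule.mem_top
  refine ⟨u, hu, Finset.eq_of_subset_of_card_le hus ?_⟩
  have h3 := hc.three_le_hammingNorm_dual hn hu hu0
  rw [h4, card_supp]
  by_contra hlt
  exact hno _ (hc.supp_mem_lines_of_mem_dual hu (by omega)) hus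

theorem hasMinDist_dual (hc : IsTripleConfiguration H t) (hn : 4 ≤ n) :
    HasMinDist (dual (codeOfMatrix H)) 3 := by
  refine hasMinDist_of_hammingNorm (by norm_num) ?_ fun u => hc.three_le_hammingNorm_dual hn
  have hS := line_mem_lines (t := t) (i := ⟨0, by omega⟩) (j := ⟨1, by omega⟩) (by simp)
  obtain ⟨u, hu, h⟩ := hc.exists_mem_dual_supp_eq_line hn hS
  exact ⟨u, hu, by rw [← card_supp, h, card_of_mem_lines hc.toIsThirdPoint hS]⟩

end IsTripleConfiguration

/-! ### The designs -/

theorem isSimpleDesign_lines (ht : IsThirdPoint t) (hn : 3 ≤ n) :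
    IsSimpleDesign 2 n 3 1 (lines t).val :=
  isSimpleDesign_two (by norm_num) hn (fun b hb => card_of_mem_lines ht hb)
    fun i j hij => by rw [filter_lines_pair ht hij, Finset.card_singleton]

theorem isSimpleDesign_quadArcs (ht : IsThirdPoint t) (hn : 4 ≤ n) :
    IsSimpleDesign 2 n 4 ((n - 3) * (n - 6) / 2) (quadArcs t).val :=
  isSimpleDesign_two (by norm_num) hn (fun b hb => (Finset.mem_filter.1 hb).2.1)
    fun i j hij => by
      have := two_mul_card_quadArcs_through_pair ht hij
      rw [Fintype.card_fin] at this
      omega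

theorem isSimpleDesign_image_compl_lines (ht : IsThirdPoint t) (hn : 5 ≤ n) :
    IsSimpleDesign 2 n (n - 3) ((lines t).card + 1 - (n - 1))
      ((lines t).image Compl.compl).val := by
  refine isSimpleDesign_two (by omega) (by omega) ?_ fun i j hij => ?_
  · intro b hb
    obtain ⟨S, hS, rfl⟩ := Finset.mem_image.1 hb
    rw [Finset.card_compl, card_of_mem_lines ht hS, Fintype.card_fin]
  · rw [Finset.filter_image, Finset.card_image_of_injective _ compl_injective]
    simp only [Finset.mem_compl]
    have := card_lines_avoiding ht hij
    rw [Fintype.card_fin] at this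
    omega

namespace IsTripleConfiguration

variable [DecidableEq F] [Fintype F]

theorem isBlocks_dual_three (hc : IsTripleConfiguration H t) (hn : 4 ≤ n) :
    IsBlocks (dual (codeOfMatrix H)) 3 (lines t).val := by
  refine isBlocks_of_minimal_supports (by norm_num)
    (fun b hb => card_of_mem_lines hc.toIsThirdPoint hb)
    (fun b hb => hc.exists_mem_dual_supp_eq_line hn hb)
    (fun u hu h3 => hc.supp_mem_lines_of_mem_dual hu h3) fun b hb d hd hdb => ?_
  by_contra h0
  have h1 := Finset.card_lt_card hdb
  have h2 := hc.three_le_hammingNorm_dual hn hd h0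
  rw [card_of_mem_lines hc.toIsThirdPoint hb, card_supp] at h1
  omega

theorem isBlocks_dual_four (hc : IsTripleConfiguration H t) (hn : 4 ≤ n) :
    IsBlocks (dual (codeOfMatrix H)) 4 (quadArcs t).val := by
  refine isBlocks_of_minimal_supports (by norm_num)
    (fun b hb => (Finset.mem_filter.1 hb).2.1)
    (fun b hb => hc.exists_mem_dual_supp_eq_quadArc hn hb)
    (fun u hu h4 => hc.supp_mem_quadArcs_of_mem_dual hu h4) fun b hb d hd hdb => ?_
  by_contra h0
  have h1 := Finset.card_lt_card hdb
  have h2 := hc.three_le_hammingNorm_dual hn hd h0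
  obtain ⟨h4, hno⟩ := (Finset.mem_filter.1 hb).2
  rw [h4, card_supp] at h1
  exact hno _ (hc.supp_mem_lines_of_mem_dual hd (by omega)) hdb.1

theorem isBlocks_code (hc : IsTripleConfiguration H t) (hn : 4 ≤ n) :
    IsBlocks (codeOfMatrix H) (n - 3) ((lines t).image Compl.compl).val := by
  have hcard : ∀ b ∈ (lines t).image Compl.compl, b.card = n - 3 := by
    intro b hb
    obtain ⟨S, hS, rfl⟩ := Finset.mem_image.1 hb
    rw [Finset.card_compl, card_of_mem_lines hc.toIsThirdPoint hS, Fintype.card_fin]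
  refine isBlocks_of_minimal_supports (by omega) hcard ?_ ?_ ?_
  · intro b hb
    obtain ⟨S, hS, rfl⟩ := Finset.mem_image.1 hb
    exact hc.exists_mem_supp_eq_compl hS
  · intro c hcC hw
    obtain ⟨f, rfl⟩ : ∃ f, f ᵥ* H = c := mem_codeOfMatrix.1 hcC
    have hf : f ≠ 0 := by
      rintro rfl
      rw [Matrix.zero_vecMul, hammingNorm_zero] at hw
      omega
    have := hammingNorm_add_card_compl_supp (f ᵥ* H)
    rcases hc.card_compl_supp_cases hf with h | h | h
    · omega
    · omega
    · exact Finset.mem_image.2 ⟨_, h, compl_compl _⟩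
  · intro b hb d hd hdb
    by_contra h0
    have h1 := Finset.card_lt_card hdb
    have h2 := hc.sub_three_le_hammingNorm hd h0
    rw [hcard b hb, card_supp] at h1
    omega

/-! ### The weight distribution -/

theorem card_codewordsOfWeight (hc : IsTripleConfiguration H t) (hn : 4 ≤ n) (w : ℕ) :
    (codewordsOfWeight (codeOfMatrix H) w).card
      = (Finset.univ.filter fun f : Fin 3 → F => hammingNorm (f ᵥ* H) = w).card := by
  symm
  refine Finset.card_bij (fun f _ => f ᵥ* H) ?_ (fun f _ g _ h => hc.vecMul_injective hn h) ?_
  · intro f hf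
    rw [mem_codewordsOfWeight]
    exact ⟨mem_codeOfMatrix.2 ⟨f, rfl⟩, (Finset.mem_filter.1 hf).2⟩
  · intro c hcw
    obtain ⟨hcC, hw⟩ := mem_codewordsOfWeight.1 hcw
    obtain ⟨f, rfl⟩ : ∃ f, f ᵥ* H = c := mem_codeOfMatrix.1 hcC
    exact ⟨f, by simpa using hw, rfl⟩

theorem card_forms_vanishing_at (hc : IsTripleConfiguration H t) (hn : 4 ≤ n) (i : Fin n) :
    (Finset.univ.filter fun f : Fin 3 → F => (f ᵥ* H) i = 0).card = Fintype.card F ^ 2 := by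
  let φ : (Fin 3 → F) →ₗ[F] F := (LinearMap.proj i).comp H.vecMulLinear
  have hφ : φ ≠ 0 := by
    intro h0
    have : Nontrivial (Fin n) := Fin.nontrivial_iff_two_le.2 (by omega)
    obtain ⟨j, hj⟩ := exists_ne i
    obtain ⟨S, hS, -, hiS⟩ := exists_mem_lines_avoiding hc.toIsThirdPoint (by simpa using hn) hj
    obtain ⟨f, -, hf⟩ := hc.exists_form_of_mem_lines hS
    exact hiS ((hf i).1 (LinearMap.congr_fun h0 f))
  have h1 := Module.Dual.finrank_ker_add_one_of_ne_zero hφ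
  rw [Module.finrank_fin_fun] at h1
  have h2 : Module.finrank F (LinearMap.ker φ) = 2 := by omega
  rw [← h2, ← Nat.card_eq_fintype_card, ← Module.natCard_eq_pow_finrank, ← Fintype.card_subtype,
    ← Nat.card_eq_fintype_card]
  rfl

theorem card_codewordsOfWeight_eq_sum (hc : IsTripleConfiguration H t) (hn : 4 ≤ n) {w : ℕ}
    (hw : 0 < w) : (codewordsOfWeight (codeOfMatrix H) w).card
      = ∑ f ∈ Finset.univ.erase (0 : Fin 3 → F), if hammingNorm (f ᵥ* H) = w then 1 else 0 := by
  rw [hc.card_codewordsOfWeight hn, ← Finset.card_filter]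
  congr 1
  ext f
  simp only [Finset.mem_filter, Finset.mem_univ, true_and, Finset.mem_erase, and_true, ne_eq]
  refine ⟨fun h => ⟨?_, h⟩, fun h => h.2⟩
  rintro rfl
  rw [Matrix.zero_vecMul, hammingNorm_zero] at h
  omega

theorem sum_card_codewordsOfWeight (hc : IsTripleConfiguration H t) (hn : 4 ≤ n) :
    (codewordsOfWeight (codeOfMatrix H) n).card
      + (codewordsOfWeight (codeOfMatrix H) (n - 1)).card
      + (codewordsOfWeight (codeOfMatrix H) (n - 3)).card + 1 = Fintype.card F ^ 3 := by
  rw [hc.card_codewordsOfWeight_eq_sum hn (by omega),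
    hc.card_codewordsOfWeight_eq_sum hn (by omega),
    hc.card_codewordsOfWeight_eq_sum hn (by omega), ← Finset.sum_add_distrib,
    ← Finset.sum_add_distrib]
  have h : (Finset.univ.erase (0 : Fin 3 → F)).card + 1 = Fintype.card F ^ 3 := by
    rw [Finset.card_erase_add_one (Finset.mem_univ _), Finset.card_univ, Fintype.card_fun,
      Fintype.card_fin]
  rw [← h, Finset.card_eq_sum_ones]
  congr 1
  refine Finset.sum_congr rfl fun f hf => ?_
  have := hc.hammingNorm_cases hn (Finset.ne_of_mem_erase hf)
  split_ifs <;> omega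

/-- Double counting of the pairs of a nonzero codeword and a position where it vanishes. -/
theorem sum_zeros_codewordsOfWeight (hc : IsTripleConfiguration H t) (hn : 4 ≤ n) :
    (codewordsOfWeight (codeOfMatrix H) (n - 1)).card
      + 3 * (codewordsOfWeight (codeOfMatrix H) (n - 3)).card
      = n * (Fintype.card F ^ 2 - 1) := by
  rw [hc.card_codewordsOfWeight_eq_sum hn (by omega),
    hc.card_codewordsOfWeight_eq_sum hn (by omega),
    Finset.mul_sum, ← Finset.sum_add_distrib]
  have h := Finset.sum_card_bipartiteAbove_eq_sum_card_bipartiteBelow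
    (s := Finset.univ.erase (0 : Fin 3 → F)) (t := (Finset.univ : Finset (Fin n)))
    (fun f i => (f ᵥ* H) i = 0)
  have h2 : ∀ i ∈ (Finset.univ : Finset (Fin n)),
      ((Finset.univ.erase (0 : Fin 3 → F)).bipartiteBelow (fun f i => (f ᵥ* H) i = 0) i).card
        = Fintype.card F ^ 2 - 1 := by
    intro i _
    rw [← hc.card_forms_vanishing_at hn i, Finset.bipartiteBelow, Finset.filter_erase,
      Finset.card_erase_of_mem]
    simp
  rw [Finset.sum_congr rfl h2, Finset.sum_const, Finset.card_univ, Fintype.card_fin,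
    smul_eq_mul] at h
  rw [← h]
  refine Finset.sum_congr rfl fun f hf => ?_
  have hz : Finset.univ.bipartiteAbove (fun f i => (f ᵥ* H) i = 0) f = (supp (f ᵥ* H))ᶜ := by
    ext i
    simp [Finset.bipartiteAbove, mem_supp]
  rw [hz]
  have := hammingNorm_add_card_compl_supp (f ᵥ* H)
  have := hc.card_compl_supp (Finset.ne_of_mem_erase hf)
  split_ifs <;> omega

theorem weightEnumerator_eq (hc : IsTripleConfiguration H t) (hn : 4 ≤ n) :
    weightEnumerator (codeOfMatrix H) = 1
      + Polynomial.C ((codewordsOfWeight (codeOfMatrix H) (n - 3)).card : ℚ) * X ^ (n - 3)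
      + Polynomial.C ((codewordsOfWeight (codeOfMatrix H) (n - 1)).card : ℚ) * X ^ (n - 1)
      + Polynomial.C ((codewordsOfWeight (codeOfMatrix H) n).card : ℚ) * X ^ n := by
  have h0 : (codewordsOfWeight (codeOfMatrix H) 0).card = 1 := by
    rw [Finset.card_eq_one]
    refine ⟨0, ?_⟩
    ext c
    rw [mem_codewordsOfWeight, Finset.mem_singleton, hammingNorm_eq_zero]
    exact ⟨fun h => h.2, fun h => ⟨h ▸ Submodule.zero_mem _, h⟩⟩
  have hsub : ({0, n - 3, n - 1, n} : Finset ℕ) ⊆ Finset.range (n + 1) := by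
    intro x hx
    simp only [Finset.mem_insert, Finset.mem_singleton] at hx
    rw [Finset.mem_range]
    omega
  rw [weightEnumerator, ← Finset.sum_subset hsub, Finset.sum_insert, Finset.sum_insert,
    Finset.sum_insert, Finset.sum_singleton, h0]
  · simp only [Nat.cast_one, map_one, pow_zero, mul_one]
    ring
  · simp only [Finset.mem_singleton]
    omega
  · simp only [Finset.mem_insert, Finset.mem_singleton]
    omega
  · simp only [Finset.mem_insert, Finset.mem_singleton]
    omega
  · intro w _ hw
    simp only [Finset.mem_insert, Finset.mem_singleton, not_or] at hw
    have : (codewordsOfWeight (codeOfMatrix H) w).card = 0 := by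
      rw [hc.card_codewordsOfWeight_eq_sum hn (by omega)]
      refine Finset.sum_eq_zero fun f hf => if_neg fun h => ?_
      have := hc.hammingNorm_cases hn (Finset.ne_of_mem_erase hf)
      omega
    rw [this, Nat.cast_zero, map_zero, zero_mul]

end IsTripleConfiguration

end Configuration

/-! ### Linearized polynomials of degree two in a field endomorphism -/

section Linearized

variable {F : Type*} [Field F] {φ : F →+* F}

/-- Two roots of `g₀ φ² + g₁ φ + g₂` outside `{0, 1}` differ by `0` or `1` if `1` is also a root.
Then `g₀ + g₁ + g₂ = 0`, the polynomial is `(g₀ φ - g₂) ∘ (φ - 1)`, and a nonzero root of the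
first factor is unique up to multiplication by fixed points of `φ`. -/
theorem eq_or_eq_add_one_of_linearized_roots (hφ : ∀ x, φ x = x → x = 0 ∨ x = 1)
    {g₀ g₁ g₂ x y : F} (hg : g₀ ≠ 0 ∨ g₁ ≠ 0 ∨ g₂ ≠ 0) (h1 : g₀ + g₁ + g₂ = 0)
    (hx : g₀ * φ (φ x) + g₁ * φ x + g₂ * x = 0) (hy : g₀ * φ (φ y) + g₁ * φ y + g₂ * y = 0)
    (hx0 : x ≠ 0) (hx1 : x ≠ 1) (hy0 : y ≠ 0) (hy1 : y ≠ 1) : x = y ∨ x = y + 1 := by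
  have hd : φ x - x ≠ 0 := fun h => (hφ x (sub_eq_zero.1 h)).elim hx0 hx1
  have he : φ y - y ≠ 0 := fun h => (hφ y (sub_eq_zero.1 h)).elim hy0 hy1
  have hdx : g₀ * φ (φ x - x) = g₂ * (φ x - x) := by
    rw [map_sub]; linear_combination hx - φ x * h1
  have hey : g₀ * φ (φ y - y) = g₂ * (φ y - y) := by
    rw [map_sub]; linear_combination hy - φ y * h1
  generalize hdd : φ x - x = d at *
  generalize hee : φ y - y = e at *
  have hg0 : g₀ ≠ 0 := by
    rintro rfl
    have h2 : g₂ = 0 := by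
      rw [zero_mul, eq_comm, mul_eq_zero] at hdx
      exact hdx.resolve_right hd
    subst h2
    simp_all
  have hde : φ (d / e) = d / e := by
    rw [map_div₀, div_eq_div_iff ((map_ne_zero φ).2 he) he]
    refine mul_left_cancel₀ hg0 ?_
    linear_combination e * hdx - d * hey
  have hd_eq : d = e := by
    rcases hφ _ hde with h | h
    · exact absurd h (div_ne_zero hd he)
    · exact (div_eq_one_iff_eq he).1 h
  have hxy : φ (x - y) = x - y := by
    rw [map_sub]; linear_combination hdd - hee + hd_eq
  rcases hφ _ hxy with h | h
  · exact Or.inl (sub_eq_zero.1 h)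
  · exact Or.inr (by linear_combination h)

/-- A nonzero linearized polynomial `g₀ φ² + g₁ φ + g₂` with two nonzero roots `a ≠ b` has exactly
the nonzero roots `a`, `b` and `a + b`. -/
theorem linearized_root_iff [CharP F 2] (hφ : ∀ x, φ x = x → x = 0 ∨ x = 1) {g₀ g₁ g₂ a b c : F}
    (hg : g₀ ≠ 0 ∨ g₁ ≠ 0 ∨ g₂ ≠ 0) (ha0 : a ≠ 0) (hb0 : b ≠ 0) (hc0 : c ≠ 0) (hab : a ≠ b)
    (ha : g₀ * φ (φ a) + g₁ * φ a + g₂ * a = 0) (hb : g₀ * φ (φ b) + g₁ * φ b + g₂ * b = 0) :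
    g₀ * φ (φ c) + g₁ * φ c + g₂ * c = 0 ↔ c = a ∨ c = b ∨ c = a + b := by
  constructor
  · intro hc
    by_cases hca : c = a
    · exact Or.inl hca
    -- rescale so that the root `a` becomes `1`
    have hroot : ∀ z, g₀ * φ (φ z) + g₁ * φ z + g₂ * z = 0 →
        g₀ * φ (φ a) * φ (φ (z / a)) + g₁ * φ a * φ (z / a) + g₂ * a * (z / a) = 0 := by
      intro z hz
      rw [mul_assoc, mul_assoc, mul_assoc, ← map_mul φ (φ a), ← map_mul φ a, mul_div_cancel₀ _ ha0]
      exact hz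
    have ha1 : φ a ≠ 0 := (map_ne_zero φ).2 ha0
    have ha2 : φ (φ a) ≠ 0 := (map_ne_zero φ).2 ha1
    have hne : ∀ z, z ≠ a → z / a ≠ 1 := fun z hz h => hz ((div_eq_one_iff_eq ha0).1 h)
    rcases eq_or_eq_add_one_of_linearized_roots hφ (g₀ := g₀ * φ (φ a)) (g₁ := g₁ * φ a)
      (g₂ := g₂ * a) (by simpa [ha0] using hg) ha (hroot c hc) (hroot b hb)
      (div_ne_zero hc0 ha0) (hne c hca) (div_ne_zero hb0 ha0) (hne b hab.symm) with h | h
    · exact Or.inr (Or.inl ((div_left_inj' ha0).1 h))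
    · refine Or.inr (Or.inr ?_)
      field_simp at h
      rw [h, add_comm]
  · rintro (rfl | rfl | rfl)
    · exact ha
    · exact hb
    · simp only [map_add]
      linear_combination ha + hb

end Linearized

/-! ### The columns of the matrix -/

section Field

open Matrix

variable {F : Type*} [Field F]

/-- A parametrization of the nonzero elements of `F` turns addition into a third-point operation
on the parameters. -/
theorem exists_thirdPoint_of_param [CharP F 2] {P : Type*} {e : P → F}
    (he : Function.Injective e) (he0 : ∀ i, e i ≠ 0) (hsurj : ∀ y, y ≠ 0 → ∃ i, e i = y) :
    ∃ t : P → P → P, IsThirdPoint t ∧ ∀ i j, i ≠ j → e (t i j) = e i + e j := by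
  have hex : ∀ i j, ∃ k, i ≠ j → e k = e i + e j := by
    intro i j
    by_cases hij : i = j
    · exact ⟨i, fun h => absurd hij h⟩
    · obtain ⟨k, hk⟩ := hsurj (e i + e j) fun h => hij (he (CharTwo.add_eq_zero.1 h))
      exact ⟨k, fun _ => hk⟩
  choose t ht using hex
  have hne : ∀ i j, i ≠ j → t i j ≠ i := by
    intro i j hij h
    have := ht i j hij
    rw [h] at this
    exact he0 j (by linear_combination -this)
  refine ⟨t, ⟨fun i j => ?_, hne, fun i j hij => he ?_⟩, ht⟩
  · by_cases hij : i = j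
    · rw [hij]
    · exact he (by rw [ht i j hij, ht j i (Ne.symm hij), add_comm])
  · rw [ht _ _ (hne i j hij).symm, ht i j hij, CharTwo.add_cancel_left]

/-- Write `s = 2 ^ h` and `x = α ^ (i + 1)`. As `s - 1` is coprime to `q - 1`, there is a unique
`y = E i` with `x * y ^ (s - 1) = 1`, and multiplication by `y ^ (s ^ 2)` turns the column
`(1, x ^ s, x ^ (s + 1))` into `(y ^ (s ^ 2), y ^ s, y)`. Hence a codeword vanishes at the roots of
a linearized polynomial, and the third-point operation is the addition of the parameters `y`. -/
theorem exists_isTripleConfiguration_matrixH [Fintype F] [DecidableEq F] {q m h : ℕ}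
    (hq : q = 2 ^ m) (hF : Fintype.card F = q) (hgcd : Nat.gcd m h = 1)
    (α : Fˣ) (hα : ∀ x : Fˣ, x ∈ Subgroup.zpowers α) :
    ∃ t, IsTripleConfiguration (matrixH (q - 1) h α) t := by
  have : CharP F 2 := by
    refine charP_of_card_eq_prime_pow (f := m) ?_
    rw [hF, hq]
  have hcard : Nat.card Fˣ = q - 1 := by rw [Nat.card_eq_fintype_card, Fintype.card_units, hF]
  have hcop : (Nat.card Fˣ).Coprime (2 ^ h - 1) := by
    rw [hcard, hq, Nat.Coprime, Nat.pow_sub_one_gcd_pow_sub_one, hgcd]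
    rfl
  have hpos : 0 < 2 ^ h := by positivity
  let φ : F →+* F := iterateFrobenius F 2 h
  have hφd : ∀ x, φ x = x ^ 2 ^ h := fun x => iterateFrobenius_def 2 h x
  have hφ : ∀ x, φ x = x → x = 0 ∨ x = 1 := by
    intro x hx
    by_cases hx0 : x = 0
    · exact Or.inl hx0
    · refine Or.inr (congrArg Units.val ((powCoprime hcop).injective (a₁ := Units.mk0 x hx0)
        (a₂ := 1) (Units.ext ?_)))
      rw [powCoprime_apply, powCoprime_apply, one_pow, Units.val_pow_eq_pow_val, Units.val_mk0,
        Units.val_one]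
      refine mul_right_cancel₀ hx0 ?_
      rw [← pow_succ, Nat.sub_add_cancel hpos, ← hφd, hx, one_mul]
  have hord : orderOf α = q - 1 := by rw [orderOf_eq_card_of_forall_mem_zpowers hα, hcard]
  have hinj : Function.Injective fun i : Fin (q - 1) => α ^ ((i : ℕ) + 1) := by
    intro i j hij
    simp only [pow_succ, mul_left_inj] at hij
    refine Fin.ext (pow_injOn_Iio_orderOf ?_ ?_ hij)
    · rw [hord]; exact i.2
    · rw [hord]; exact j.2
  have hbij : Function.Bijective fun i : Fin (q - 1) => α ^ ((i : ℕ) + 1) := by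
    rw [Fintype.bijective_iff_injective_and_card]
    exact ⟨hinj, by rw [Fintype.card_fin, ← hcard, Nat.card_eq_fintype_card]⟩
  -- `E i` is the `(2 ^ h - 1)`-th root of the inverse of `α ^ (i + 1)`
  let E : Fin (q - 1) ≃ Fˣ :=
    ((Equiv.ofBijective _ hbij).trans (Equiv.inv Fˣ)).trans (powCoprime hcop).symm
  have hE : ∀ i : Fin (q - 1), α ^ ((i : ℕ) + 1) * E i ^ (2 ^ h - 1) = 1 := by
    intro i
    have : powCoprime hcop (E i) = (α ^ ((i : ℕ) + 1))⁻¹ :=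
      (powCoprime hcop).apply_symm_apply _
    rw [powCoprime_apply] at this
    rw [this, mul_inv_cancel]
  have hE' : ∀ i : Fin (q - 1), (α : F) ^ ((i : ℕ) + 1) * φ (E i) = E i := by
    intro i
    have h1 := congrArg Units.val (hE i)
    rw [Units.val_mul, Units.val_pow_eq_pow_val, Units.val_pow_eq_pow_val, Units.val_one] at h1
    rw [hφd, ← Nat.sub_add_cancel hpos, pow_succ (E i : F), ← mul_assoc]
    exact (congrArg (· * (E i : F)) h1).trans (one_mul _)
  obtain ⟨t, ht, hadd⟩ := exists_thirdPoint_of_param (e := fun i => (E i : F))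
    (fun i j h => E.injective (Units.ext h)) (fun i => (E i).ne_zero)
    (fun y hy => ⟨E.symm (Units.mk0 y hy), by simp⟩)
  have hval : ∀ (f : Fin 3 → F) i, (f ᵥ* matrixH (q - 1) h α) i * φ (φ (E i))
      = f 0 * φ (φ (E i)) + f 1 * φ (E i) + f 2 * E i := by
    intro f i
    have h1 := hE' i
    have h2 : ((α : F) ^ ((i : ℕ) + 1)) ^ 2 ^ h * φ (φ (E i)) = φ (E i) := by
      rw [← hφd, ← map_mul, h1]
    simp only [vecMul, dotProduct, Fin.sum_univ_three, matrixH, of_apply, cons_val_zero,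
      cons_val_one, cons_val]
    rw [pow_succ _ (2 ^ h)]
    linear_combination (f 1 + f 2 * (α : F) ^ ((i : ℕ) + 1)) * h2 + f 2 * h1
  have hzero : ∀ (f : Fin 3 → F) i, (f ᵥ* matrixH (q - 1) h α) i = 0 ↔
      f 0 * φ (φ (E i)) + f 1 * φ (E i) + f 2 * E i = 0 := by
    intro f i
    rw [← hval, mul_eq_zero, or_iff_left]
    exact (map_ne_zero φ).2 ((map_ne_zero φ).2 (E i).ne_zero)
  have heq : ∀ i j, (E i : F) = E j ↔ i = j := fun i j =>
    ⟨fun h => E.injective (Units.ext h), fun h => by rw [h]⟩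
  refine ⟨t, ht, fun f hf i j hij hi hj k => ?_⟩
  rw [hzero] at hi hj ⊢
  have hf' : f 0 ≠ 0 ∨ f 1 ≠ 0 ∨ f 2 ≠ 0 := by
    by_contra hall
    push Not at hall
    refine hf (funext fun r => ?_)
    fin_cases r
    · exact hall.1
    · exact hall.2.1
    · exact hall.2.2
  rw [linearized_root_iff hφ hf' (E i).ne_zero (E j).ne_zero (E k).ne_zero
    (fun h => hij ((heq i j).1 h)) hi hj, ← hadd i j hij, heq, heq, heq]
  simp only [Finset.mem_insert, Finset.mem_singleton]

end Field

end NearMDS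

theorem theorem3p2 {F : Type*} [Field F] [Fintype F] [DecidableEq F] (q m h : ℕ)
    (hm : 3 ≤ m) (hq : q = 2 ^ m) (hF : Fintype.card F = q)
    (hh : 0 < h) (hgcd : Nat.gcd m h = 1)
    (α : Fˣ) (hα : ∀ x : Fˣ, x ∈ Subgroup.zpowers α) :
    NearMDS.HasParameters (NearMDS.codeH q h α) 3 (q - 4) ∧
    NearMDS.IsNMDS (NearMDS.codeH q h α) ∧
    NearMDS.weightEnumerator (NearMDS.codeH q h α) =
      1 + Polynomial.C (((q : ℚ) - 1) ^ 2 * ((q : ℚ) - 2) / 6) * X ^ (q - 4)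
        + Polynomial.C (((q : ℚ) - 1) ^ 2 * ((q : ℚ) + 4) / 2) * X ^ (q - 2)
        + Polynomial.C (((q : ℚ) - 1) * ((q : ℚ) ^ 2 + 8) / 3) * X ^ (q - 1) ∧
    -- the minimum weight codewords of the code
    (∃ lam : ℕ, (lam : ℚ) = ((q : ℚ) - 4) * ((q : ℚ) - 5) / 6 ∧
      NearMDS.SupportsSimpleDesign (NearMDS.codeH q h α) (q - 4) 2 lam) ∧
    -- the minimum weight codewords of the dual code, whose minimum distance is 3
    NearMDS.HasParameters (NearMDS.dual (NearMDS.codeH q h α)) (q - 4) 3 ∧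
    NearMDS.SupportsSimpleDesign (NearMDS.dual (NearMDS.codeH q h α)) 3 2 1 ∧
    NearMDS.SupportsSteinerSystem (NearMDS.dual (NearMDS.codeH q h α)) 3 2 ∧
    -- the codewords of weight 4 of the dual code
    (∃ lam : ℕ, (lam : ℚ) = ((q : ℚ) - 4) * ((q : ℚ) - 7) / 2 ∧
      NearMDS.SupportsSimpleDesign (NearMDS.dual (NearMDS.codeH q h α)) 4 2 lam) := by
  obtain ⟨t, hc⟩ := NearMDS.exists_isTripleConfiguration_matrixH hq hF hgcd α hα
  have ht := hc.toIsThirdPoint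
  have hq8 : 8 ≤ q := by
    rw [hq]
    exact le_trans (by norm_num) (Nat.pow_le_pow_right (by norm_num) hm)
  have hn : 4 ≤ q - 1 := by omega
  have e4 : q - 1 - 3 = q - 4 := by omega
  have e2 : q - 1 - 1 = q - 2 := by omega
  have hdim := hc.finrank_code hn
  have hdim' := hc.finrank_dual hn
  have hdist := hc.hasMinDist_code hn
  have hdist' := hc.hasMinDist_dual hn
  have hblk := hc.isBlocks_code hn
  have hsum := hc.sum_card_codewordsOfWeight hn
  have hzeros := hc.sum_zeros_codewordsOfWeight hn
  have henum := hc.weightEnumerator_eq hn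
  have hmin := hblk.card_codewordsOfWeight
  have hdes := NearMDS.isSimpleDesign_image_compl_lines ht (by omega)
  have hlines := NearMDS.six_mul_card_lines ht
  rw [Finset.card_image_of_injective _ compl_injective] at hmin
  rw [Fintype.card_fin] at hlines
  rw [hF] at hsum hzeros hmin
  rw [e4] at hdim' hdist hblk hsum hzeros henum hmin hdes
  rw [e2] at hsum hzeros henum hdes hlines
  have c1 : ((q - 1 : ℕ) : ℚ) = q - 1 := by rw [Nat.cast_sub (by omega), Nat.cast_one]
  have c2 : ((q - 2 : ℕ) : ℚ) = q - 2 := by rw [Nat.cast_sub (by omega), Nat.cast_ofNat]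
  have c22 : ((q ^ 2 - 1 : ℕ) : ℚ) = (q : ℚ) ^ 2 - 1 := by
    rw [Nat.cast_sub (Nat.one_le_pow _ _ (by omega)), Nat.cast_pow, Nat.cast_one]
  have hlines' : 6 * ((NearMDS.lines t).card : ℚ) = (q - 1) * (q - 2) := by
    rw [← c1, ← c2]; exact_mod_cast hlines
  have hmin' : ((NearMDS.codewordsOfWeight (NearMDS.codeH q h α) (q - 4)).card : ℚ)
      = (q - 1) * (NearMDS.lines t).card := by
    rw [← c1]; exact_mod_cast hmin
  have hzeros' : ((NearMDS.codewordsOfWeight (NearMDS.codeH q h α) (q - 2)).card : ℚ)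
      + 3 * (NearMDS.codewordsOfWeight (NearMDS.codeH q h α) (q - 4)).card
      = (q - 1) * ((q : ℚ) ^ 2 - 1) := by
    rw [← c1, ← c22]; exact_mod_cast hzeros
  have hsum' : ((NearMDS.codewordsOfWeight (NearMDS.codeH q h α) (q - 1)).card : ℚ)
      + (NearMDS.codewordsOfWeight (NearMDS.codeH q h α) (q - 2)).card
      + (NearMDS.codewordsOfWeight (NearMDS.codeH q h α) (q - 4)).card + 1 = (q : ℚ) ^ 3 := by
    exact_mod_cast hsum
  refine ⟨⟨hdim, hdist⟩, ⟨?_, ?_⟩, ?_, ⟨_, ?_, _, hblk, hdes⟩, ⟨hdim', hdist'⟩,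
    ⟨_, hc.isBlocks_dual_three hn, NearMDS.isSimpleDesign_lines ht (by omega)⟩,
    ⟨_, hc.isBlocks_dual_three hn, le_rfl, NearMDS.isSimpleDesign_lines ht (by omega)⟩,
    ⟨_, ?_, _, hc.isBlocks_dual_four hn, NearMDS.isSimpleDesign_quadArcs ht hn⟩⟩
  · unfold NearMDS.IsAMDS NearMDS.codeH
    rw [hdim, e4]
    exact hdist
  · unfold NearMDS.IsAMDS NearMDS.codeH
    rw [hdim', show q - 1 - (q - 4) = 3 by omega]
    exact hdist'
  · refine henum.trans ?_
    have v4 : ((NearMDS.codewordsOfWeight (NearMDS.codeH q h α) (q - 4)).card : ℚ)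
        = ((q : ℚ) - 1) ^ 2 * ((q : ℚ) - 2) / 6 := by
      linear_combination hmin' + (q - 1) / 6 * hlines'
    have v2 : ((NearMDS.codewordsOfWeight (NearMDS.codeH q h α) (q - 2)).card : ℚ)
        = ((q : ℚ) - 1) ^ 2 * ((q : ℚ) + 4) / 2 := by
      linear_combination hzeros' - 3 * v4
    have v1 : ((NearMDS.codewordsOfWeight (NearMDS.codeH q h α) (q - 1)).card : ℚ)
        = ((q : ℚ) - 1) * ((q : ℚ) ^ 2 + 8) / 3 := by
      linear_combination hsum' - v2 - v4
    rw [← v4, ← v2, ← v1]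
    rfl
  -- the subtraction in the number of blocks does not truncate
  · have hle : q - 2 ≤ (NearMDS.lines t).card + 1 := by
      have : 6 * (q - 2) ≤ 6 * (NearMDS.lines t).card := by
        rw [hlines]
        exact Nat.mul_le_mul_right _ (by omega)
      omega
    rw [Nat.cast_sub hle, c2, Nat.cast_add, Nat.cast_one]
    linear_combination hlines' / 6
  · obtain ⟨N, rfl⟩ : ∃ N, q = N + 8 := ⟨q - 8, by omega⟩
    have heven : 2 ∣ (N + 8 - 1 - 3) * (N + 8 - 1 - 6) := by
      rcases Nat.even_or_odd' N with ⟨k, rfl | rfl⟩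
      · exact dvd_mul_of_dvd_left (by omega) _
      · exact dvd_mul_of_dvd_right (by omega) _
    -- the division by two is exact
    rw [Nat.cast_div heven (by norm_num)]
    have d1 : N + 8 - 1 - 3 = N + 4 := by omega
    have d2 : N + 8 - 1 - 6 = N + 1 := by omega
    rw [d1, d2]
    push_cast
    ring
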